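/- Let $d\ge 1$ be an integer and let $s\in(0,1]$. For $f\in\ell^1(\mathbb Z^d)$ and $\xi\in\mathbb T^d:=[-\pi,\pi]^d$ put $$\widehat f(\xi)=(2\pi)^{-d/2}\sum_{x\in\mathbb Z^d}f(x)e^{-i\langle x,\xi\rangle},\qquad \omega(\xi)=4\sum_{j=1}^d\sin^2(\xi_j/2),$$ let $(-\Delta)^s$ be the Fourier multiplier $\widehat{(-\Delta)^sf}=\omega^s\widehat f$, that is, $(-\Delta)^sf(x)=(2\pi)^{-d/2}\int_{\mathbb T^d}\omega(\xi)^s\widehat f(\xi)e^{i\langle x,\xi\rangle}\,d\xi$, and let $$G_t^{(s)}(x)=\frac1{(2\pi)^d}\int_{\mathbb T^d}e^{-t\omega(\xi)^s}e^{i\langle x,\xi\rangle}\,d\xi,\qquad x\in\mathbb Z^d.$$ Let $u_0\in\ell^1(\mathbb Z^d)$ (real- or complex-valued; no moment assumption) and $M=\sum_{x\in\mathbb Z^d}u_0(x)$. Then the Cauchy problem $$\partial_tu+(-\Delta)^su=0\quad(t>0),\qquad u(0)=u_0,$$ has a unique strong solution in $\ell^1(\mathbb Z^d)$ (that is, $u:[0,\infty)\to\ell^1(\mathbb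 Z^d)$ is continuous, and differentiable in the $\ell^1$ norm for $t>0$), and this solution satisfies $$\lim_{t\to\infty}\|u(t)-M\,G_t^{(s)}\|_{\ell^1(\mathbb Z^d)}=0\qquad\text{and}\qquad \lim_{t\to\infty}t^{\frac d{2s}}\|u(t)-M\,G_t^{(s)}\|_{\ell^\infty(\mathbb Z^d)}=0.$$ Consequently, for every $1\le p\le\infty$ (with $1/\infty=0$), $$\lim_{t\to\infty}t^{\frac d{2s}\left(1-\frac1p\right)}\|u(t)-M\,G_t^{(s)}\|_{\ell^p(\mathbb Z^d)}=0.$$ -/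

import Mathlib

open MeasureTheory Filter Topology
open scoped ENNReal

noncomputable section

namespace LatticeHeat

/-- The space `ℓ¹(ℤᵈ)` of absolutely summable functions on the lattice, with its norm. -/
abbrev Ell1 (d : ℕ) : Type := lp (fun _ : Fin d → ℤ => ℂ) 1

/-- The pairing `⟨x, ξ⟩ = ∑ⱼ xⱼ ξⱼ` of a lattice point and a frequency. -/
def pairing {d : ℕ} (x : Fin d → ℤ) (ξ : Fin d → ℝ) : ℝ := ∑ j, (x j : ℝ) * ξ j

/-- The frequency domain `𝕋ᵈ = [-π, π]ᵈ`. -/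
def torus (d : ℕ) : Set (Fin d → ℝ) := Set.Icc (fun _ => -Real.pi) (fun _ => Real.pi)

/-- The symbol `ω(ξ) = 4 ∑ⱼ sin²(ξⱼ / 2)` of the discrete Laplacian `-Δ`. -/
def symbol {d : ℕ} (ξ : Fin d → ℝ) : ℝ := 4 * ∑ j, Real.sin (ξ j / 2) ^ 2

/-- The Fourier transform `f̂(ξ) = (2π)^(-d/2) ∑ₓ f(x) e^{-i⟨x, ξ⟩}` of `f ∈ ℓ¹(ℤᵈ)`. -/
def fourier {d : ℕ} (f : Ell1 d) (ξ : Fin d → ℝ) : ℂ :=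
  (((2 * Real.pi) ^ (-(d : ℝ) / 2) : ℝ) : ℂ) *
    ∑' x : Fin d → ℤ, f x * Complex.exp (-(Complex.I * (pairing x ξ : ℂ)))

/-- The inverse transform `x ↦ (2π)^(-d/2) ∫_{𝕋ᵈ} g(ξ) e^{i⟨x, ξ⟩} dξ`. -/
def invFourier {d : ℕ} (g : (Fin d → ℝ) → ℂ) (x : Fin d → ℤ) : ℂ :=
  (((2 * Real.pi) ^ (-(d : ℝ) / 2) : ℝ) : ℂ) *
    ∫ ξ in torus d, g ξ * Complex.exp (Complex.I * (pairing x ξ : ℂ))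

/-- The fractional Laplacian `(-Δ)^s` on `ℓ¹(ℤᵈ)`: the Fourier multiplier with symbol `ω(ξ)^s`. -/
def fracLaplacian {d : ℕ} (s : ℝ) (f : Ell1 d) : (Fin d → ℤ) → ℂ :=
  invFourier (fun ξ => ((symbol ξ ^ s : ℝ) : ℂ) * fourier f ξ)

/-- The lattice fractional heat kernel
`G_t^{(s)}(x) = (2π)^(-d) ∫_{𝕋ᵈ} e^{-t ω(ξ)^s} e^{i⟨x, ξ⟩} dξ`. -/
def heatKernel {d : ℕ} (s t : ℝ) (x : Fin d → ℤ) : ℂ :=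
  ((((2 * Real.pi) ^ d)⁻¹ : ℝ) : ℂ) *
    ∫ ξ in torus d, ((Real.exp (-t * symbol ξ ^ s) : ℝ) : ℂ) *
      Complex.exp (Complex.I * (pairing x ξ : ℂ))

/-- `u` is a (strong) solution in `ℓ¹(ℤᵈ)` of `∂ₜ u + (-Δ)^s u = 0` for `t > 0`, `u(0) = u₀`.
Only the values `u t` with `t ≥ 0` matter. -/
structure IsSolution {d : ℕ} (s : ℝ) (u₀ : Ell1 d) (u : ℝ → Ell1 d) : Prop where
  initial : u 0 = u₀
  continuousOn : ContinuousOn u (Set.Ici 0)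
  equation : ∀ t : ℝ, 0 < t → ∃ v : Ell1 d, HasDerivAt u v t ∧
    ∀ x : Fin d → ℤ, v x + fracLaplacian s (u t) x = 0

/-- The mass `M = ∑ₓ u₀(x)`. -/
def mass {d : ℕ} (u₀ : Ell1 d) : ℂ := ∑' x : Fin d → ℤ, u₀ x

/-- The `ℓᵖ(ℤᵈ)` norm, `0 < p ≤ ∞`, with respect to the counting measure, with value `∞` on the
functions that do not belong to `ℓᵖ(ℤᵈ)`. -/
def ellNorm {d : ℕ} (p : ℝ≥0∞) (f : (Fin d → ℤ) → ℂ) : ℝ≥0∞ := eLpNorm f p Measure.count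

end LatticeHeat

end

/-!
Let `P` be the nearest neighbour average on `ℓ¹(ℤᵈ)`. Then `(-Δ)^s = (2d)^s (1 - Q)`, where
`Q = 1 - (1 - P)^s = ∑ₖ cₖ P^(k+1)` has weights `cₖ ≥ 0` of total mass at most one. For a unit
translation `τ` one may split off a positive multiple of `τ` from `Q`, so that `e^{-t(-Δ)^s}` is
the Poisson semigroup `e^{r(τ - 1)}`, with `r` proportional to `t`, times a commuting contraction.
If `N` is Poisson of mean `r`, then `‖e^{r(τ - 1)}(1 - τ)‖ ≤ 𝔼|1 - N/r| ≤ r^(-1/2)`. Hence unit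
translations, and therefore all translations, become invisible to the semigroup as `t → ∞`, and
`e^{-t(-Δ)^s}(δ_y - δ_0) → 0` in `ℓ¹`; summing against `u₀` gives the case `p = 1`. The on-diagonal
bound `O(t^(-d/2s))` on one half of the time interval turns this into the case `p = ∞`, and
interpolation gives the rest.
-/

open scoped lp

noncomputable section

namespace LatticeHeat

theorem norm_sub_mul_smul_le {E : Type*} [SeminormedAddCommGroup E] [NormedSpace ℝ E] {Q P T : E}
    {a b : ℝ} (ha : 0 ≤ a) (hQ : ‖Q - a • P‖ ≤ 1 - a) (hP : ‖P - b • T‖ ≤ 1 - b) :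
    ‖Q - (a * b) • T‖ ≤ 1 - a * b := by
  calc ‖Q - (a * b) • T‖ = ‖(Q - a • P) + a • (P - b • T)‖ := by congr 1; module
    _ ≤ ‖Q - a • P‖ + ‖a • (P - b • T)‖ := norm_add_le _ _
    _ ≤ (1 - a) + a * (1 - b) := by rw [norm_smul, Real.norm_of_nonneg ha]; gcongr
    _ = 1 - a * b := by ring

section BanachAlgebra

variable {A : Type*} [NormedRing A] [NormedAlgebra ℝ A] [CompleteSpace A]

theorem exp_add_of_commute {x y : A} (h : Commute x y) :
    NormedSpace.exp (x + y) = NormedSpace.exp x * NormedSpace.exp y :=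
  let _ : NormedAlgebra ℚ A := NormedAlgebra.restrictScalars ℚ ℝ A
  NormedSpace.exp_add_of_commute h

theorem exp_smul_sub_smul_one (T : A) (ρ t : ℝ) :
    NormedSpace.exp (t • (T - ρ • (1 : A))) = Real.exp (-(t * ρ)) • NormedSpace.exp (t • T) := by
  have hone : NormedSpace.exp ((-(t * ρ)) • (1 : A)) = Real.exp (-(t * ρ)) • (1 : A) := by
    rw [Real.exp_eq_exp_ℝ, ← Algebra.algebraMap_eq_smul_one, ← Algebra.algebraMap_eq_smul_one,
      ← NormedSpace.algebraMap_exp_comm]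
  rw [show t • (T - ρ • (1 : A)) = t • T + (-(t * ρ)) • (1 : A) by module,
    exp_add_of_commute ((Commute.one_right _).smul_right _), hone, mul_smul_comm, mul_one]

variable [NormOneClass A]

theorem norm_exp_le (x : A) : ‖NormedSpace.exp x‖ ≤ Real.exp ‖x‖ := by
  have hr := NormedSpace.exp_series_hasSum_exp' (𝕂 := ℝ) ‖x‖
  rw [← Real.exp_eq_exp_ℝ] at hr
  rw [← (NormedSpace.exp_series_hasSum_exp' (𝕂 := ℝ) x).tsum_eq]
  refine tsum_of_norm_bounded hr fun n => ?_
  rw [norm_smul, norm_inv, Real.norm_natCast, smul_eq_mul]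
  gcongr
  exact norm_pow_le x n

theorem norm_exp_smul_sub_smul_one_le_one {T : A} {ρ t : ℝ} (hT : ‖T‖ ≤ ρ) (ht : 0 ≤ t) :
    ‖NormedSpace.exp (t • (T - ρ • (1 : A)))‖ ≤ 1 := by
  rw [exp_smul_sub_smul_one, norm_smul, Real.norm_of_nonneg (Real.exp_pos _).le]
  calc Real.exp (-(t * ρ)) * ‖NormedSpace.exp (t • T)‖
      ≤ Real.exp (-(t * ρ)) * Real.exp (t * ρ) := by
        gcongr
        refine (norm_exp_le _).trans (Real.exp_le_exp.2 ?_)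
        rw [norm_smul, Real.norm_of_nonneg ht]
        gcongr
    _ = 1 := by rw [← Real.exp_add, neg_add_cancel, Real.exp_zero]

theorem norm_exp_smul_sub_one_le_one {T : A} {t : ℝ} (hT : ‖T‖ ≤ 1) (ht : 0 ≤ t) :
    ‖NormedSpace.exp (t • (T - 1))‖ ≤ 1 := by
  simpa only [one_smul] using norm_exp_smul_sub_smul_one_le_one hT ht

end BanachAlgebra

section Poisson

theorem hasSum_poisson (r : ℝ) : HasSum (fun n : ℕ => r ^ n / n.factorial) (Real.exp r) := by
  rw [Real.exp_eq_exp_ℝ]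
  exact NormedSpace.expSeries_div_hasSum_exp r

theorem succ_mul_pow_div_factorial_succ (r : ℝ) (n : ℕ) :
    ((n + 1 : ℕ) : ℝ) * (r ^ (n + 1) / (n + 1).factorial) = r * (r ^ n / n.factorial) := by
  rw [Nat.factorial_succ]
  push_cast
  field_simp
  ring

theorem hasSum_poisson_mean (r : ℝ) :
    HasSum (fun n : ℕ => n * (r ^ n / n.factorial)) (r * Real.exp r) := by
  rw [← hasSum_nat_add_iff' 1]
  convert! (hasSum_poisson r).mul_left r using 1
  · funext n
    exact succ_mul_pow_div_factorial_succ r n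
  · simp

theorem hasSum_poisson_sq (r : ℝ) :
    HasSum (fun n : ℕ => (n : ℝ) ^ 2 * (r ^ n / n.factorial)) ((r ^ 2 + r) * Real.exp r) := by
  rw [← hasSum_nat_add_iff' 1]
  convert! ((hasSum_poisson_mean r).add (hasSum_poisson r)).mul_left r using 1
  · funext n
    rw [pow_two, mul_assoc, succ_mul_pow_div_factorial_succ]
    push_cast
    ring
  · rw [Finset.sum_range_one]
    push_cast
    ring

theorem hasSum_poisson_sq_deviation {r : ℝ} (hr : r ≠ 0) :
    HasSum (fun n : ℕ => (1 - n / r) ^ 2 * (r ^ n / n.factorial)) (Real.exp r / r) := by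
  convert! ((hasSum_poisson r).sub ((hasSum_poisson_mean r).mul_left (2 / r))).add
    ((hasSum_poisson_sq r).mul_left (1 / r ^ 2)) using 1
  · funext n
    ring
  · field_simp
    ring

variable {A : Type*} [NormedRing A] [NormedAlgebra ℝ A] [CompleteSpace A]

theorem hasSum_exp_smul_mul_one_sub (T : A) {r : ℝ} (hr : r ≠ 0) :
    HasSum (fun n : ℕ => ((1 - n / r) * (r ^ n / n.factorial)) • T ^ n)
      (NormedSpace.exp (r • T) * (1 - T)) := by
  have hexp : HasSum (fun n : ℕ => (r ^ n / n.factorial) • T ^ n) (NormedSpace.exp (r • T)) := by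
    convert! NormedSpace.exp_series_hasSum_exp' (𝕂 := ℝ) (r • T) using 2 with n
    rw [smul_pow, smul_smul, div_eq_inv_mul]
  have hexp_mul : HasSum (fun n : ℕ => (n / r * (r ^ n / n.factorial)) • T ^ n)
      (NormedSpace.exp (r • T) * T) := by
    rw [← hasSum_nat_add_iff' 1]
    convert! hexp.mul_right T using 1
    · funext n
      rw [smul_mul_assoc, ← pow_succ, div_mul_eq_mul_div, succ_mul_pow_div_factorial_succ,
        mul_div_cancel_left₀ _ hr]
    · simp
  rw [mul_sub, mul_one]
  simpa only [sub_smul, sub_mul, one_mul] using hexp.sub hexp_mul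

variable [NormOneClass A]

theorem norm_exp_smul_mul_one_sub_le {T : A} (hT : ‖T‖ ≤ 1) {r : ℝ} (hr : 0 < r) :
    ‖NormedSpace.exp (r • T) * (1 - T)‖ ≤ Real.exp r / √r := by
  have hmajorant : HasSum (fun n : ℕ => (√r * (1 - n / r) ^ 2 + 1 / √r) / 2 *
      (r ^ n / n.factorial)) (Real.exp r / √r) := by
    convert! ((hasSum_poisson_sq_deviation hr.ne').mul_left (√r / 2)).add
      ((hasSum_poisson r).mul_left (1 / √r / 2)) using 1
    · funext n
      ring
    · field_simp
      rw [Real.sq_sqrt hr.le]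
      ring
  -- AM-GM, with weights balancing the variance `1 / r` of the normalized Poisson law
  have hdev (x : ℝ) : |x| ≤ (√r * x ^ 2 + 1 / √r) / 2 := by
    have hsq : (√r * x ^ 2 + 1 / √r) / 2 - |x| = (√r * |x| - 1) ^ 2 / (2 * √r) := by
      rw [← sq_abs x]
      field_simp
      ring
    linarith [show 0 ≤ (√r * |x| - 1) ^ 2 / (2 * √r) by positivity]
  rw [← (hasSum_exp_smul_mul_one_sub T hr.ne').tsum_eq]
  refine tsum_of_norm_bounded hmajorant fun n => ?_
  rw [norm_smul, norm_mul, Real.norm_eq_abs, Real.norm_of_nonneg (by positivity)]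
  refine (mul_le_of_le_one_right (by positivity)
    ((norm_pow_le T n).trans (pow_le_one₀ (norm_nonneg _) hT))).trans ?_
  gcongr
  exact hdev _

theorem norm_exp_smul_sub_one_mul_one_sub_le {T : A} (hT : ‖T‖ ≤ 1) {r : ℝ} (hr : 0 < r) :
    ‖NormedSpace.exp (r • (T - 1)) * (1 - T)‖ ≤ 1 / √r := by
  have hexp := exp_smul_sub_smul_one T 1 r
  rw [one_smul, mul_one] at hexp
  rw [hexp, smul_mul_assoc, norm_smul, Real.norm_of_nonneg (Real.exp_pos _).le]
  calc Real.exp (-r) * ‖NormedSpace.exp (r • T) * (1 - T)‖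
      ≤ Real.exp (-r) * (Real.exp r / √r) := by
        gcongr
        exact norm_exp_smul_mul_one_sub_le hT hr
    _ = 1 / √r := by rw [← mul_div_assoc, ← Real.exp_add, neg_add_cancel, Real.exp_zero]

-- Splitting off the part `c • T` of the generator leaves a commuting contraction semigroup.
theorem norm_exp_smul_sub_one_mul_one_sub_le_of_norm_sub_smul_le {Q T : A} {c t : ℝ}
    (hTQ : Commute T Q) (hT : ‖T‖ ≤ 1) (hQ : ‖Q - c • T‖ ≤ 1 - c) (hc : 0 < c) (ht : 0 < t) :
    ‖NormedSpace.exp (t • (Q - 1)) * (1 - T)‖ ≤ 1 / √(t * c) := by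
  set R := (Q - c • T) - (1 - c) • (1 : A)
  have hTR : Commute T R := (hTQ.sub_right ((Commute.refl T).smul_right _)).sub_right
    ((Commute.one_right _).smul_right _)
  have hcomm : Commute (t • R) ((t * c) • (T - 1)) :=
    ((hTR.symm.sub_right (Commute.one_right _)).smul_right _).smul_left _
  rw [show t • (Q - 1) = t • R + (t * c) • (T - 1) by module, exp_add_of_commute hcomm, mul_assoc]
  refine (norm_mul_le _ _).trans ((mul_le_of_le_one_left (norm_nonneg _)
    (norm_exp_smul_sub_smul_one_le_one hQ ht.le)).trans ?_)
  exact norm_exp_smul_sub_one_mul_one_sub_le hT (by positivity)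

end Poisson

section Binomial

/-- The coefficients of `1 - (1 - x)^s = ∑ₖ cₖ x^(k+1)`; for `s ∈ (0, 1]` they are the weights of
the discrete subordinator of index `s`. -/
def fracCoeff (s : ℝ) (k : ℕ) : ℝ := (-1) ^ k * Ring.choose s (k + 1)

theorem choose_succ_mul (s : ℝ) (k : ℕ) :
    Ring.choose s (k + 1) * (k + 1) = Ring.choose s k * (s - k) := by
  rw [Ring.choose_eq_smul, Ring.choose_eq_smul, descPochhammer_succ_right, Nat.factorial_succ]
  simp only [Polynomial.smeval_mul, Polynomial.smeval_sub, Polynomial.smeval_X,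
    Polynomial.smeval_natCast, smul_eq_mul]
  push_cast
  field_simp
  simp

theorem fracCoeff_zero (s : ℝ) : fracCoeff s 0 = s := by
  simp [fracCoeff]

theorem fracCoeff_succ (s : ℝ) (k : ℕ) :
    fracCoeff s (k + 1) = fracCoeff s k * ((k + 1 - s) / (k + 2)) := by
  have hchoose := choose_succ_mul s (k + 1)
  unfold fracCoeff
  push_cast at hchoose
  field_simp
  rw [pow_succ]
  linear_combination (-1) ^ k * (-1) * hchoose

theorem fracCoeff_nonneg {s : ℝ} (hs0 : 0 ≤ s) (hs1 : s ≤ 1) (k : ℕ) : 0 ≤ fracCoeff s k := by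
  induction k with
  | zero => rwa [fracCoeff_zero]
  | succ k ih =>
    rw [fracCoeff_succ]
    exact mul_nonneg ih (div_nonneg (by linarith [k.cast_nonneg (α := ℝ)]) (by positivity))

theorem hasSum_fracCoeff_mul_pow_of_lt {s x : ℝ} (hx : |x| < 1) :
    HasSum (fun k => fracCoeff s k * x ^ (k + 1)) (1 - (1 - x) ^ s) := by
  have h := (Real.one_add_rpow_hasFPowerSeriesOnBall_zero (a := s)).hasSum (y := -x)
    (by simpa [enorm_eq_nnnorm] using! hx)
  simp only [binomialSeries_apply, List.ofFn_const, List.prod_replicate, smul_eq_mul,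
    zero_add] at h
  rw [← hasSum_nat_add_iff' 1] at h
  simp only [Finset.range_one, Finset.sum_singleton, Ring.choose_zero_right, pow_zero,
    mul_one] at h
  convert! h.neg using 1
  · funext k
    rw [fracCoeff, neg_pow x, pow_succ (-1 : ℝ)]
    ring
  · rw [← sub_eq_add_neg, neg_sub]

theorem sum_fracCoeff_le_one {s : ℝ} (hs0 : 0 ≤ s) (hs1 : s ≤ 1) (F : Finset ℕ) :
    ∑ k ∈ F, fracCoeff s k ≤ 1 := by
  have hc : Tendsto (fun x : ℝ => ∑ k ∈ F, fracCoeff s k * x ^ (k + 1)) (𝓝[<] 1)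
      (𝓝 (∑ k ∈ F, fracCoeff s k * 1 ^ (k + 1))) :=
    (Continuous.tendsto (by fun_prop) 1).mono_left nhdsWithin_le_nhds
  simp only [one_pow, mul_one] at hc
  refine le_of_tendsto hc ?_
  filter_upwards [Ioo_mem_nhdsLT (show (0 : ℝ) < 1 by norm_num)] with x hx
  have h := hasSum_fracCoeff_mul_pow_of_lt (s := s) (x := x) (by rw [abs_of_pos hx.1]; exact hx.2)
  refine (sum_le_hasSum F (fun k _ => mul_nonneg (fracCoeff_nonneg hs0 hs1 k)
    (pow_nonneg hx.1.le _)) h).trans ?_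
  exact sub_le_self _ (Real.rpow_nonneg (by linarith [hx.2]) _)

theorem summable_fracCoeff {s : ℝ} (hs0 : 0 ≤ s) (hs1 : s ≤ 1) : Summable (fracCoeff s) :=
  summable_of_sum_le (fracCoeff_nonneg hs0 hs1) (sum_fracCoeff_le_one hs0 hs1)

theorem tsum_fracCoeff_le_one {s : ℝ} (hs0 : 0 ≤ s) (hs1 : s ≤ 1) : ∑' k, fracCoeff s k ≤ 1 :=
  (summable_fracCoeff hs0 hs1).tsum_le_of_sum_le (sum_fracCoeff_le_one hs0 hs1)

theorem hasSum_fracCoeff_mul_pow {s x : ℝ} (hs0 : 0 < s) (hs1 : s ≤ 1) (hx : |x| ≤ 1) :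
    HasSum (fun k => fracCoeff s k * x ^ (k + 1)) (1 - (1 - x) ^ s) := by
  have hbd : ∀ (k : ℕ) (y : ℝ), y ∈ Set.Icc (-1 : ℝ) 1 →
      ‖fracCoeff s k * y ^ (k + 1)‖ ≤ fracCoeff s k := fun k y hy => by
    rw [norm_mul, norm_pow, Real.norm_of_nonneg (fracCoeff_nonneg hs0.le hs1 k)]
    exact mul_le_of_le_one_right (fracCoeff_nonneg hs0.le hs1 k)
      (pow_le_one₀ (norm_nonneg _) (abs_le.2 hy))
  have hcont : ContinuousOn (fun y : ℝ => ∑' k, fracCoeff s k * y ^ (k + 1)) (Set.Icc (-1) 1) :=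
    continuousOn_tsum (fun k => by fun_prop) (summable_fracCoeff hs0.le hs1) hbd
  have hcont' : ContinuousOn (fun y : ℝ => 1 - (1 - y) ^ s) (Set.Icc (-1) 1) :=
    (continuous_const.sub ((continuous_const.sub continuous_id).rpow_const
      fun _ => Or.inr hs0.le)).continuousOn
  have heq : Set.EqOn (fun y : ℝ => ∑' k, fracCoeff s k * y ^ (k + 1))
      (fun y : ℝ => 1 - (1 - y) ^ s) (Set.Icc (-1) 1) := by
    refine Set.EqOn.of_subset_closure (s := Set.Ioo (-1 : ℝ) 1) (fun y hy => ?_) hcont hcont'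
      Set.Ioo_subset_Icc_self (by rw [closure_Ioo (by norm_num)])
    exact (hasSum_fracCoeff_mul_pow_of_lt (abs_lt.2 hy)).tsum_eq
  have hx' := abs_le.1 hx
  rw [show 1 - (1 - x) ^ s = _ from (heq hx').symm]
  exact (Summable.of_norm_bounded (summable_fracCoeff hs0.le hs1)
    fun k => hbd k x hx').hasSum

end Binomial

section Subordinate

variable {A : Type*} [NormedRing A] [NormedAlgebra ℝ A]

/-- The operator `Q = ∑ₖ cₖ P^(k+1)` with `1 - Q = (1 - P)^s`, for a contraction `P`. -/
def subordinate (s : ℝ) (P : A) : A := ∑' k, fracCoeff s k • P ^ (k + 1)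

variable {s : ℝ} {P : A}

theorem norm_fracCoeff_smul_pow_le (hs0 : 0 ≤ s) (hs1 : s ≤ 1) (hP : ‖P‖ ≤ 1) (k : ℕ) :
    ‖fracCoeff s k • P ^ (k + 1)‖ ≤ fracCoeff s k := by
  rw [norm_smul, Real.norm_of_nonneg (fracCoeff_nonneg hs0 hs1 k)]
  exact mul_le_of_le_one_right (fracCoeff_nonneg hs0 hs1 k)
    ((norm_pow_le' _ k.succ_pos).trans (pow_le_one₀ (norm_nonneg _) hP))

theorem norm_subordinate_le_one (hs0 : 0 ≤ s) (hs1 : s ≤ 1) (hP : ‖P‖ ≤ 1) :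
    ‖subordinate s P‖ ≤ 1 :=
  (tsum_of_norm_bounded (summable_fracCoeff hs0 hs1).hasSum
    (norm_fracCoeff_smul_pow_le hs0 hs1 hP)).trans (tsum_fracCoeff_le_one hs0 hs1)

variable [CompleteSpace A]

theorem hasSum_subordinate (hs0 : 0 ≤ s) (hs1 : s ≤ 1) (hP : ‖P‖ ≤ 1) :
    HasSum (fun k => fracCoeff s k • P ^ (k + 1)) (subordinate s P) :=
  (Summable.of_norm_bounded (summable_fracCoeff hs0 hs1)
    (norm_fracCoeff_smul_pow_le hs0 hs1 hP)).hasSum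

theorem norm_subordinate_sub_smul_le (hs0 : 0 ≤ s) (hs1 : s ≤ 1) (hP : ‖P‖ ≤ 1) :
    ‖subordinate s P - s • P‖ ≤ 1 - s := by
  have htail := (hasSum_nat_add_iff' (f := fun k => fracCoeff s k • P ^ (k + 1)) 1).2
    (hasSum_subordinate hs0 hs1 hP)
  have htail_coeff := (hasSum_nat_add_iff' 1).2 (summable_fracCoeff hs0 hs1).hasSum
  simp only [Finset.range_one, Finset.sum_singleton, fracCoeff_zero, zero_add, pow_one]
    at htail htail_coeff
  rw [← htail.tsum_eq]
  refine (tsum_of_norm_bounded htail_coeff fun k =>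
    norm_fracCoeff_smul_pow_le hs0 hs1 hP _).trans ?_
  gcongr
  exact tsum_fracCoeff_le_one hs0 hs1

theorem commute_subordinate (hs0 : 0 ≤ s) (hs1 : s ≤ 1) (hP : ‖P‖ ≤ 1) {T : A}
    (hTP : Commute T P) : Commute T (subordinate s P) := by
  have hsum := hasSum_subordinate hs0 hs1 hP
  refine (hsum.mul_left T).unique ?_
  convert! hsum.mul_right T using 2 with k
  exact ((hTP.pow_right _).smul_right _).eq

end Subordinate

section Eigenfunctional

variable {E : Type*} [NormedAddCommGroup E] [NormedSpace ℂ E]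
  {X : E →L[ℂ] E} {Λ : E →L[ℂ] ℂ} {m : ℂ}

theorem eigenfunctional_pow (hX : ∀ f, Λ (X f) = m * Λ f) (n : ℕ) (f : E) :
    Λ ((X ^ n) f) = m ^ n * Λ f := by
  induction n with
  | zero => simp
  | succ n ih => rw [pow_succ', mul_apply_eq_comp, hX, ih, pow_succ', mul_assoc]

theorem eigenfunctional_hasSum {ι : Type*} {a : ι → ℂ} {e : ι → ℕ} {Y : E →L[ℂ] E} {y : ℂ}
    (hX : ∀ f, Λ (X f) = m * Λ f) (hY : HasSum (fun i => a i • X ^ e i) Y)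
    (hy : HasSum (fun i => a i * m ^ e i) y) (f : E) : Λ (Y f) = y * Λ f := by
  refine ((Λ ∘L ContinuousLinearMap.apply ℂ E f).hasSum hY).unique ?_
  convert! hy.mul_right (Λ f) using 2 with i
  simp [mul_assoc, ← eigenfunctional_pow hX]

variable [CompleteSpace E]

theorem eigenfunctional_exp (hX : ∀ f, Λ (X f) = m * Λ f) (f : E) :
    Λ (NormedSpace.exp X f) = Complex.exp m * Λ f := by
  rw [Complex.exp_eq_exp_ℂ]
  exact eigenfunctional_hasSum hX (NormedSpace.exp_series_hasSum_exp' (𝕂 := ℂ) X)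
    (NormedSpace.exp_series_hasSum_exp' (𝕂 := ℂ) m) f

theorem eigenfunctional_subordinate {s x : ℝ} (hs0 : 0 < s) (hs1 : s ≤ 1) (hX : ‖X‖ ≤ 1)
    (hx : |x| ≤ 1) (hΛ : ∀ f, Λ (X f) = x * Λ f) (f : E) :
    Λ (subordinate s X f) = ((1 - (1 - x) ^ s : ℝ) : ℂ) * Λ f := by
  refine eigenfunctional_hasSum (a := fun k => (fracCoeff s k : ℂ)) hΛ
    (hasSum_subordinate hs0.le hs1 hX) ?_ f
  exact_mod_cast Complex.hasSum_ofReal.2 (hasSum_fracCoeff_mul_pow hs0 hs1 hx)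

end Eigenfunctional

section UnitMass

variable {G : Type*}

theorem summable_norm (f : ℓ¹(G, ℂ)) : Summable fun x => ‖f x‖ := by
  simpa using (lp.memℓp f).summable (by simp)

theorem norm_eq_tsum (f : ℓ¹(G, ℂ)) : ‖f‖ = ∑' x, ‖f x‖ := by
  simpa using lp.norm_eq_tsum_rpow (by simp) f

variable [DecidableEq G]

/-- The unit mass at `y`, as an element of `ℓ¹(G)`. -/
def delta (y : G) : ℓ¹(G, ℂ) := lp.single 1 y 1

theorem delta_apply (y x : G) : delta y x = if x = y then 1 else 0 := by
  rw [delta, lp.single_apply, Pi.single_apply]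

theorem norm_delta (y : G) : ‖delta y‖ = 1 := by
  rw [delta, lp.norm_single one_pos, norm_one]

end UnitMass

section Translation

variable {G : Type*} [AddCommGroup G]

theorem memℓp_comp_sub (f : ℓ¹(G, ℂ)) (y : G) :
    Memℓp (E := fun _ : G => ℂ) (fun x => f (x - y)) 1 := by
  refine memℓp_gen ?_
  simpa [Function.comp_def] using (Equiv.subRight y).summable_iff.2 (summable_norm f)

/-- Translation `f ↦ f (· - y)` on `ℓ¹(G)`. -/
def translate (y : G) : ℓ¹(G, ℂ) →L[ℂ] ℓ¹(G, ℂ) :=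
  LinearMap.mkContinuous
    { toFun := fun f => ⟨fun x => f (x - y), memℓp_comp_sub f y⟩
      map_add' := fun f g => by ext x; rfl
      map_smul' := fun c f => by ext x; rfl } 1 fun f => by
    rw [one_mul, norm_eq_tsum, norm_eq_tsum]
    exact ((Equiv.subRight y).tsum_eq fun x => ‖f x‖).le

@[simp]
theorem translate_apply (y : G) (f : ℓ¹(G, ℂ)) (x : G) : translate y f x = f (x - y) := rfl

theorem norm_translate_le (y : G) : ‖translate y‖ ≤ 1 :=
  LinearMap.mkContinuous_norm_le _ zero_le_one _

theorem translate_zero : translate (0 : G) = 1 := by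
  ext f x
  simp

theorem translate_add (y z : G) : translate (y + z) = translate y * translate z := by
  ext f x
  simp [sub_sub]

theorem commute_translate (y z : G) : Commute (translate y) (translate z) := by
  rw [commute_iff_eq, ← translate_add, ← translate_add, add_comm]

variable [DecidableEq G]

theorem translate_delta_zero (y : G) : translate y (delta 0) = delta y := by
  ext x
  simp [delta_apply, sub_eq_zero]

theorem hasSum_smul_delta_sub_delta_zero (f : ℓ¹(G, ℂ)) :
    HasSum (fun y => f y • (delta y - delta 0)) (f - (∑' x, f x) • delta 0) := by
  have hf : HasSum (fun y => f y • delta y) f := by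
    convert! lp.hasSum_single ENNReal.one_ne_top f using 2 with y
    rw [delta, ← lp.single_smul, smul_eq_mul, mul_one]
  simpa only [smul_sub] using hf.sub ((summable_norm f).of_norm.hasSum.smul_const (delta 0))

end Translation

section AsymptoticPeriods

variable {G α : Type*} [AddCommGroup G]

/-- The group of those `y` along which translation becomes invisible to the operators `S t` in the
limit along `l`, in the sense that `S t ∘ (1 - translate y)` tends to zero in operator norm. -/
def asymptoticPeriods (S : α → ℓ¹(G, ℂ) →L[ℂ] ℓ¹(G, ℂ)) (l : Filter α) : AddSubgroup G where
  carrier := {y | Tendsto (fun t => S t * (1 - translate y)) l (𝓝 0)}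
  zero_mem' := by simpa [translate_zero] using tendsto_const_nhds
  add_mem' := fun {y z} hy hz => by
    have hyz := (hy.mul_const (translate z)).add hz
    rw [zero_mul, add_zero] at hyz
    refine hyz.congr fun t => ?_
    rw [translate_add]
    noncomm_ring
  neg_mem' := fun {y} hy => by
    have hneg := (hy.mul_const (translate (-y))).neg
    rw [zero_mul, neg_zero] at hneg
    refine hneg.congr fun t => ?_
    rw [mul_assoc, sub_mul, ← translate_add, add_neg_cancel, translate_zero, one_mul, ← mul_neg,
      neg_sub]

variable [DecidableEq G] {S : α → ℓ¹(G, ℂ) →L[ℂ] ℓ¹(G, ℂ)} {l : Filter α}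

theorem tendsto_apply_delta_sub_delta_zero {y : G} (hy : y ∈ asymptoticPeriods S l) :
    Tendsto (fun t => S t (delta y - delta 0)) l (𝓝 0) := by
  have h := ((ContinuousLinearMap.apply ℂ _ (delta (0 : G))).continuous.tendsto 0).comp hy
  simpa [Function.comp_def, translate_delta_zero] using h.neg

theorem tendsto_apply_sub_tsum_smul_delta_zero (hS : asymptoticPeriods S l = ⊤) {C : ℝ}
    (hC : ∀ᶠ t in l, ‖S t‖ ≤ C) (f : ℓ¹(G, ℂ)) :
    Tendsto (fun t => S t (f - (∑' x, f x) • delta 0)) l (𝓝 0) := by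
  have hexpand (t : α) : ∑' y, f y • S t (delta y - delta 0)
      = S t (f - (∑' x, f x) • delta 0) := by
    simpa using ((S t).hasSum (hasSum_smul_delta_sub_delta_zero f)).tsum_eq
  simp_rw [← hexpand]
  suffices h : Tendsto (fun t => ∑' y, f y • S t (delta y - delta 0)) l
      (𝓝 (∑' _ : G, (0 : ℓ¹(G, ℂ)))) by rwa [tsum_zero] at h
  refine tendsto_tsum_of_dominated_convergence (bound := fun y => ‖f y‖ * (C * 2))
    ((summable_norm f).mul_right _) (fun y => ?_) (hC.mono fun t ht y => ?_)
  · simpa using (tendsto_apply_delta_sub_delta_zero (hS ▸ AddSubgroup.mem_top y)).const_smul (f y)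
  · rw [norm_smul]
    gcongr
    refine (S t).le_of_opNorm_le_of_le ht ((norm_sub_le _ _).trans ?_)
    rw [norm_delta, norm_delta, one_add_one_eq_two]

end AsymptoticPeriods

section CharacterSum

variable {d : ℕ}

theorem pairing_add (x y : Fin d → ℤ) (ξ : Fin d → ℝ) :
    pairing (x + y) ξ = pairing x ξ + pairing y ξ := by
  simp [pairing, add_mul, Finset.sum_add_distrib]

theorem pairing_sub (x y : Fin d → ℤ) (ξ : Fin d → ℝ) :
    pairing (x - y) ξ = pairing x ξ - pairing y ξ := by
  simp [pairing, sub_mul, Finset.sum_sub_distrib]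

theorem pairing_single (j : Fin d) (n : ℤ) (ξ : Fin d → ℝ) :
    pairing (Pi.single j n) ξ = n * ξ j := by
  rw [pairing, Finset.sum_eq_single j] <;> simp +contextual

@[fun_prop]
theorem continuous_pairing (x : Fin d → ℤ) : Continuous fun ξ : Fin d → ℝ => pairing x ξ := by
  unfold pairing
  fun_prop

theorem norm_mul_exp_pairing (f : Ell1 d) (ξ : Fin d → ℝ) (x : Fin d → ℤ) :
    ‖f x * Complex.exp (-(Complex.I * (pairing x ξ : ℂ)))‖ = ‖f x‖ := by
  rw [norm_mul, Complex.norm_exp]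
  simp

theorem summable_mul_exp_pairing (f : Ell1 d) (ξ : Fin d → ℝ) :
    Summable fun x => f x * Complex.exp (-(Complex.I * (pairing x ξ : ℂ))) :=
  Summable.of_norm (by simpa only [norm_mul_exp_pairing] using summable_norm f)

theorem norm_tsum_mul_exp_pairing_le (f : Ell1 d) (ξ : Fin d → ℝ) :
    ‖∑' x, f x * Complex.exp (-(Complex.I * (pairing x ξ : ℂ)))‖ ≤ ‖f‖ := by
  rw [norm_eq_tsum]
  exact tsum_of_norm_bounded (summable_norm f).hasSum fun x => (norm_mul_exp_pairing f ξ x).le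

/-- The Fourier transform at the frequency `ξ`, without its normalizing factor, as a functional on
`ℓ¹(ℤᵈ)`. -/
def charSum (ξ : Fin d → ℝ) : Ell1 d →L[ℂ] ℂ :=
  LinearMap.mkContinuous
    { toFun := fun f => ∑' x, f x * Complex.exp (-(Complex.I * (pairing x ξ : ℂ)))
      map_add' := fun f g => by
        simpa [add_mul] using
          (summable_mul_exp_pairing f ξ).tsum_add (summable_mul_exp_pairing g ξ)
      map_smul' := fun c f => by
        simp [mul_assoc, tsum_mul_left] } 1 fun f => by
    simpa using norm_tsum_mul_exp_pairing_le f ξ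

theorem charSum_apply (ξ : Fin d → ℝ) (f : Ell1 d) :
    charSum ξ f = ∑' x, f x * Complex.exp (-(Complex.I * (pairing x ξ : ℂ))) := rfl

theorem norm_charSum_le (ξ : Fin d → ℝ) (f : Ell1 d) : ‖charSum ξ f‖ ≤ ‖f‖ :=
  norm_tsum_mul_exp_pairing_le f ξ

theorem charSum_translate (ξ : Fin d → ℝ) (y : Fin d → ℤ) (f : Ell1 d) :
    charSum ξ (translate y f) = Complex.exp (-(Complex.I * (pairing y ξ : ℂ))) * charSum ξ f := by
  rw [charSum_apply, charSum_apply, ← tsum_mul_left, ← (Equiv.addRight y).tsum_eq]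
  refine tsum_congr fun x => ?_
  simp only [Equiv.coe_addRight, translate_apply, add_sub_cancel_right, pairing_add]
  push_cast
  rw [mul_add, neg_add, Complex.exp_add]
  ring

theorem charSum_delta_zero (ξ : Fin d → ℝ) : charSum ξ (delta 0) = 1 := by
  rw [charSum_apply, tsum_eq_single 0] <;> simp +contextual [delta_apply, pairing]

end CharacterSum

section Average

variable {d : ℕ}

/-- The average over the `2 * d` nearest neighbours, so that `-Δ = 2 * d * (1 - average d)`. -/
def average (d : ℕ) : Ell1 d →L[ℂ] Ell1 d :=
  (2 * d : ℝ)⁻¹ • ∑ p : Fin d × ℤˣ, translate (Pi.single p.1 (p.2 : ℤ))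

theorem norm_average_le_one (d : ℕ) : ‖average d‖ ≤ 1 := by
  rw [average, norm_smul, Real.norm_of_nonneg (by positivity)]
  refine inv_mul_le_one_of_le₀ ((norm_sum_le_of_le _ fun _ _ => norm_translate_le _).trans ?_)
    (by positivity)
  simp [mul_comm]

theorem norm_average_sub_smul_translate_le (j : Fin d) :
    ‖average d - (2 * d : ℝ)⁻¹ • translate (Pi.single j 1)‖ ≤ 1 - (2 * d : ℝ)⁻¹ := by
  have hd : (0 : ℝ) < d := Nat.cast_pos.2 j.pos
  have hsum : ‖∑ p ∈ Finset.univ.erase (j, (1 : ℤˣ)),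
      translate (Pi.single p.1 (p.2 : ℤ) : Fin d → ℤ)‖ ≤ 2 * d - 1 := by
    refine (norm_sum_le_of_le _ fun _ _ => norm_translate_le _).trans ?_
    simp [Finset.card_erase_of_mem, mul_comm, Nat.cast_sub (show 1 ≤ d * 2 by have := j.pos; lia)]
  rw [average, ← Finset.add_sum_erase _ _ (Finset.mem_univ (j, (1 : ℤˣ))), smul_add, Units.val_one,
    add_sub_cancel_left, norm_smul, Real.norm_of_nonneg (by positivity)]
  calc (2 * d : ℝ)⁻¹ * _ ≤ (2 * d : ℝ)⁻¹ * (2 * d - 1) := by gcongr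
    _ = 1 - (2 * d : ℝ)⁻¹ := by field_simp

theorem commute_translate_average (y : Fin d → ℤ) : Commute (translate y) (average d) :=
  (Commute.sum_right _ _ _ fun _ _ => commute_translate _ _).smul_right _

theorem symbol_nonneg (ξ : Fin d → ℝ) : 0 ≤ symbol ξ := by
  unfold symbol
  positivity

theorem symbol_le (ξ : Fin d → ℝ) : symbol ξ ≤ 4 * d := by
  unfold symbol
  gcongr
  simpa using Finset.sum_le_sum fun j (_ : j ∈ Finset.univ) => Real.sin_sq_le_one (ξ j / 2)

@[fun_prop]
theorem continuous_symbol : Continuous fun ξ : Fin d → ℝ => symbol ξ := by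
  unfold symbol
  fun_prop

theorem sum_charSum_translate_single (ξ : Fin d → ℝ) (j : Fin d) (f : Ell1 d) :
    ∑ u : ℤˣ, charSum ξ (translate (Pi.single j (u : ℤ)) f)
      = ((2 - 4 * Real.sin (ξ j / 2) ^ 2 : ℝ) : ℂ) * charSum ξ f := by
  have hcos : 2 - 4 * Real.sin (ξ j / 2) ^ 2 = 2 * Real.cos (ξ j) := by
    rw [Real.sin_sq_eq_half_sub, mul_div_cancel₀ _ (two_ne_zero' ℝ)]
    ring
  rw [hcos]
  push_cast
  rw [Complex.two_cos, mul_comm (ξ j : ℂ), neg_mul, mul_comm (ξ j : ℂ)]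
  simp only [UnitsInt.univ, charSum_translate, pairing_single, Complex.ofReal_mul,
    Complex.ofReal_intCast, Finset.mem_singleton, units_ne_neg_self, not_false_eq_true,
    Finset.sum_insert, Units.val_one, Int.cast_one, one_mul, Finset.sum_singleton, Units.val_neg,
    Int.reduceNeg, Int.cast_neg, neg_mul, mul_neg, neg_neg]
  ring

theorem charSum_average [NeZero d] (ξ : Fin d → ℝ) (f : Ell1 d) :
    charSum ξ (average d f) = ((1 - symbol ξ / (2 * d) : ℝ) : ℂ) * charSum ξ f := by
  have hmean : 1 - symbol ξ / (2 * d)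
      = (2 * d : ℝ)⁻¹ * ∑ j, (2 - 4 * Real.sin (ξ j / 2) ^ 2) := by
    have hd : (d : ℝ) ≠ 0 := NeZero.ne _
    rw [Finset.sum_sub_distrib, ← Finset.mul_sum, ← symbol, Finset.sum_const, Finset.card_fin,
      nsmul_eq_mul]
    field_simp
  have hsum : charSum ξ (∑ p : Fin d × ℤˣ, translate (Pi.single p.1 (p.2 : ℤ)) f)
      = ((∑ j, (2 - 4 * Real.sin (ξ j / 2) ^ 2) : ℝ) : ℂ) * charSum ξ f := by
    rw [map_sum, Fintype.sum_prod_type, Complex.ofReal_sum, Finset.sum_mul]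
    exact Finset.sum_congr rfl fun j _ => sum_charSum_translate_single ξ j f
  rw [hmean, Complex.ofReal_mul, mul_assoc, ← hsum, average]
  simp

end Average

section Semigroup

variable {d : ℕ} {s t : ℝ}

instance : Nontrivial (Ell1 d) :=
  ⟨delta 0, 0, fun h => by simpa [norm_delta] using congrArg norm h⟩

/-- `(-Δ)^s` as the bounded operator `(2d)^s (1 - P)^s` on `ℓ¹(ℤᵈ)`, with `P = average d`. -/
def fracOp (d : ℕ) (s : ℝ) : Ell1 d →L[ℂ] Ell1 d :=
  (2 * d : ℝ) ^ s • (1 - subordinate s (average d))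

/-- The semigroup `e^{-t(-Δ)^s}` on `ℓ¹(ℤᵈ)`. -/
def semigroup (d : ℕ) (s t : ℝ) : Ell1 d →L[ℂ] Ell1 d := NormedSpace.exp (t • -fracOp d s)

theorem charSum_fracOp [NeZero d] (hs0 : 0 < s) (hs1 : s ≤ 1) (ξ : Fin d → ℝ) (f : Ell1 d) :
    charSum ξ (fracOp d s f) = ((symbol ξ ^ s : ℝ) : ℂ) * charSum ξ f := by
  have hd : (0 : ℝ) < d := Nat.cast_pos.2 (NeZero.pos d)
  have hω : 0 ≤ symbol ξ / (2 * d) := div_nonneg (symbol_nonneg ξ) (by positivity)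
  have hω2 : symbol ξ / (2 * d) ≤ 2 := by
    rw [div_le_iff₀ (by positivity)]
    linarith [symbol_le ξ]
  have hscale : symbol ξ ^ s = (2 * d : ℝ) ^ s * (symbol ξ / (2 * d)) ^ s := by
    rw [← Real.mul_rpow (by positivity) hω, mul_div_cancel₀ _ (by positivity)]
  have hsub := eigenfunctional_subordinate hs0 hs1 (norm_average_le_one d)
    (abs_le.2 ⟨by linarith, by linarith⟩) (charSum_average ξ) f
  rw [sub_sub_cancel] at hsub
  have hfrac : charSum ξ (fracOp d s f)
      = (2 * d : ℝ) ^ s • (charSum ξ f - charSum ξ (subordinate s (average d) f)) := by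
    simp [fracOp]
  rw [hfrac, hsub, hscale, Complex.real_smul]
  push_cast
  ring

theorem charSum_semigroup [NeZero d] (hs0 : 0 < s) (hs1 : s ≤ 1) (t : ℝ) (ξ : Fin d → ℝ)
    (f : Ell1 d) :
    charSum ξ (semigroup d s t f) = ((Real.exp (-t * symbol ξ ^ s) : ℝ) : ℂ) * charSum ξ f := by
  rw [Complex.ofReal_exp]
  refine eigenfunctional_exp (fun g => ?_) f
  simp [charSum_fracOp hs0 hs1, mul_assoc]

theorem semigroup_zero (d : ℕ) (s : ℝ) : semigroup d s 0 = 1 := by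
  simp [semigroup]

theorem semigroup_add (d : ℕ) (s t r : ℝ) :
    semigroup d s (t + r) = semigroup d s t * semigroup d s r := by
  rw [semigroup, add_smul]
  exact exp_add_of_commute (((Commute.refl _).smul_left _).smul_right _)

theorem hasDerivAt_semigroup_apply (s : ℝ) (f : Ell1 d) (t : ℝ) :
    HasDerivAt (fun t => semigroup d s t f) (-fracOp d s (semigroup d s t f)) t :=
  ((ContinuousLinearMap.apply ℂ (Ell1 d) f).restrictScalars ℝ).hasFDerivAt.comp_hasDerivAt t
    (hasDerivAt_exp_smul_const' (𝕂 := ℝ) (-fracOp d s) t)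

theorem semigroup_eq_exp (d : ℕ) (s t : ℝ) :
    semigroup d s t
      = NormedSpace.exp ((t * (2 * d : ℝ) ^ s) • (subordinate s (average d) - 1)) := by
  rw [semigroup, fracOp]
  congr 1
  module

theorem norm_semigroup_le_one (hs0 : 0 ≤ s) (hs1 : s ≤ 1) (ht : 0 ≤ t) :
    ‖semigroup d s t‖ ≤ 1 := by
  rw [semigroup_eq_exp]
  exact norm_exp_smul_sub_one_le_one (norm_subordinate_le_one hs0 hs1 (norm_average_le_one d))
    (by positivity)

theorem norm_semigroup_mul_one_sub_translate_single_le (hs0 : 0 < s) (hs1 : s ≤ 1) (ht : 0 < t)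
    (j : Fin d) :
    ‖semigroup d s t * (1 - translate (Pi.single j 1))‖
      ≤ 1 / √(t * (2 * d : ℝ) ^ s * (s * (2 * d : ℝ)⁻¹)) := by
  have hd : (0 : ℝ) < d := Nat.cast_pos.2 j.pos
  have hP := norm_average_le_one d
  rw [semigroup_eq_exp]
  exact norm_exp_smul_sub_one_mul_one_sub_le_of_norm_sub_smul_le
    (commute_subordinate hs0.le hs1 hP (commute_translate_average _)) (norm_translate_le _)
    (norm_sub_mul_smul_le hs0.le (norm_subordinate_sub_smul_le hs0.le hs1 hP)
      (norm_average_sub_smul_translate_le j))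
    (by positivity) (by positivity)

theorem single_mem_asymptoticPeriods (hs0 : 0 < s) (hs1 : s ≤ 1) (j : Fin d) :
    Pi.single j 1 ∈ asymptoticPeriods (semigroup d s) atTop := by
  have hd : (0 : ℝ) < d := Nat.cast_pos.2 j.pos
  have hlim : Tendsto (fun t : ℝ => 1 / √(t * (2 * d : ℝ) ^ s * (s * (2 * d : ℝ)⁻¹)))
      atTop (𝓝 0) :=
    tendsto_const_nhds.div_atTop (Real.tendsto_sqrt_atTop.comp
      ((tendsto_id.atTop_mul_const (by positivity)).atTop_mul_const (by positivity)))
  exact squeeze_zero_norm' ((eventually_gt_atTop 0).mono fun t ht =>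
    norm_semigroup_mul_one_sub_translate_single_le hs0 hs1 ht j) hlim

theorem asymptoticPeriods_semigroup_eq_top (hs0 : 0 < s) (hs1 : s ≤ 1) :
    asymptoticPeriods (semigroup d s) atTop = ⊤ := by
  refine (AddSubgroup.eq_top_iff' _).2 fun y => ?_
  rw [show y = ∑ j, y j • Pi.single j (1 : ℤ) by ext i; simp [Pi.single_apply]]
  exact sum_mem fun j _ => zsmul_mem (single_mem_asymptoticPeriods hs0 hs1 j) _

theorem tendsto_semigroup_sub_mass_smul_delta_zero (hs0 : 0 < s) (hs1 : s ≤ 1) (f : Ell1 d) :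
    Tendsto (fun t => semigroup d s t (f - mass f • delta 0)) atTop (𝓝 0) :=
  tendsto_apply_sub_tsum_smul_delta_zero (asymptoticPeriods_semigroup_eq_top hs0 hs1)
    ((eventually_ge_atTop 0).mono fun _ ht => norm_semigroup_le_one hs0.le hs1 ht) f

end Semigroup

section FourierInversion

variable {d : ℕ} {s : ℝ}

theorem integral_Icc_exp_int_mul (n : ℤ) :
    ∫ θ in Set.Icc (-Real.pi) Real.pi, Complex.exp (Complex.I * ((n * θ : ℝ) : ℂ))
      = if n = 0 then ((2 * Real.pi : ℝ) : ℂ) else 0 := by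
  rw [integral_Icc_eq_integral_Ioc,
    ← intervalIntegral.integral_of_le (neg_le_self Real.pi_pos.le)]
  split_ifs with hn
  · simp [hn, two_mul]
  · have hc : Complex.I * (n : ℂ) ≠ 0 := mul_ne_zero Complex.I_ne_zero (Int.cast_ne_zero.2 hn)
    have hperiod : Complex.exp (Complex.I * n * (Real.pi : ℝ))
        = Complex.exp (Complex.I * n * ((-Real.pi : ℝ) : ℂ)) :=
      Complex.exp_eq_exp_iff_exists_int.2 ⟨n, by push_cast; ring⟩
    simp_rw [Complex.ofReal_mul, Complex.ofReal_intCast, ← mul_assoc]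
    rw [integral_exp_mul_complex hc, hperiod, sub_self, zero_div]

theorem integral_torus_exp_pairing (n : Fin d → ℤ) :
    ∫ ξ in torus d, Complex.exp (Complex.I * (pairing n ξ : ℂ))
      = if n = 0 then (((2 * Real.pi) ^ d : ℝ) : ℂ) else 0 := by
  have hprod (ξ : Fin d → ℝ) : Complex.exp (Complex.I * (pairing n ξ : ℂ))
      = ∏ j, Complex.exp (Complex.I * ((n j * ξ j : ℝ) : ℂ)) := by
    rw [← Complex.exp_sum, ← Finset.mul_sum, pairing, Complex.ofReal_sum]
  simp_rw [hprod]
  rw [torus, ← Set.pi_univ_Icc, volume_pi, Measure.restrict_pi_pi,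
    integral_fintype_prod_eq_prod
      (f := fun j (θ : ℝ) => Complex.exp (Complex.I * ((n j * θ : ℝ) : ℂ)))]
  simp_rw [integral_Icc_exp_int_mul]
  split_ifs with hn
  · simp [hn]
  · obtain ⟨j, hj⟩ := Function.ne_iff.1 hn
    exact Finset.prod_eq_zero (Finset.mem_univ j) (if_neg hj)

theorem charSum_mul_exp_pairing (f : Ell1 d) (ξ : Fin d → ℝ) (x : Fin d → ℤ) :
    charSum ξ f * Complex.exp (Complex.I * (pairing x ξ : ℂ))
      = ∑' y, f y * Complex.exp (Complex.I * (pairing (x - y) ξ : ℂ)) := by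
  rw [charSum_apply, ← tsum_mul_right]
  refine tsum_congr fun y => ?_
  rw [mul_assoc, ← Complex.exp_add, pairing_sub]
  push_cast
  congr 2
  ring

theorem integral_charSum_mul_exp_pairing (f : Ell1 d) (x : Fin d → ℤ) :
    ∫ ξ in torus d, charSum ξ f * Complex.exp (Complex.I * (pairing x ξ : ℂ))
      = (((2 * Real.pi) ^ d : ℝ) : ℂ) * f x := by
  have hint (y : Fin d → ℤ) : IntegrableOn
      (fun ξ => f y * Complex.exp (Complex.I * (pairing (x - y) ξ : ℂ))) (torus d) :=
    ContinuousOn.integrableOn_compact isCompact_Icc (by fun_prop)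
  have hnorm : Summable fun y =>
      ∫ ξ in torus d, ‖f y * Complex.exp (Complex.I * (pairing (x - y) ξ : ℂ))‖ := by
    simp_rw [norm_mul, Complex.norm_exp_I_mul_ofReal, mul_one, integral_const]
    exact (summable_norm f).const_smul _
  have hsum := hasSum_integral_of_summable_integral_norm hint hnorm
  simp_rw [← charSum_mul_exp_pairing, integral_const_mul, integral_torus_exp_pairing] at hsum
  rw [← hsum.tsum_eq, tsum_eq_single x fun y hy => by
      rw [if_neg (sub_ne_zero.2 hy.symm), mul_zero], if_pos (sub_self x), mul_comm]

theorem fourier_eq (f : Ell1 d) (ξ : Fin d → ℝ) :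
    fourier f ξ = (((2 * Real.pi) ^ (-(d : ℝ) / 2) : ℝ) : ℂ) * charSum ξ f := rfl

theorem two_pi_rpow_mul_self (d : ℕ) :
    ((2 * Real.pi) ^ (-(d : ℝ) / 2) : ℝ) * (2 * Real.pi) ^ (-(d : ℝ) / 2)
      = ((2 * Real.pi) ^ d)⁻¹ := by
  rw [← Real.rpow_add (by positivity), add_halves, Real.rpow_neg (by positivity),
    Real.rpow_natCast]

theorem inv_two_pi_pow_mul_integral_charSum (f : Ell1 d) (x : Fin d → ℤ) :
    ((((2 * Real.pi) ^ d)⁻¹ : ℝ) : ℂ) *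
      ∫ ξ in torus d, charSum ξ f * Complex.exp (Complex.I * (pairing x ξ : ℂ)) = f x := by
  rw [integral_charSum_mul_exp_pairing, ← mul_assoc, ← Complex.ofReal_mul,
    inv_mul_cancel₀ (by positivity), Complex.ofReal_one, one_mul]

theorem invFourier_fourier (f : Ell1 d) (x : Fin d → ℤ) : invFourier (fourier f) x = f x := by
  simp_rw [invFourier, fourier_eq, mul_assoc, integral_const_mul]
  rw [← mul_assoc, ← Complex.ofReal_mul, two_pi_rpow_mul_self,
    inv_two_pi_pow_mul_integral_charSum]

theorem fracLaplacian_eq [NeZero d] (hs0 : 0 < s) (hs1 : s ≤ 1) (f : Ell1 d) :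
    fracLaplacian s f = fracOp d s f := by
  funext x
  rw [← invFourier_fourier (fracOp d s f), fracLaplacian]
  congr 1
  funext ξ
  rw [fourier_eq, fourier_eq, charSum_fracOp hs0 hs1, mul_left_comm]

theorem semigroup_apply_eq [NeZero d] (hs0 : 0 < s) (hs1 : s ≤ 1) (t : ℝ) (f : Ell1 d)
    (x : Fin d → ℤ) :
    semigroup d s t f x = ((((2 * Real.pi) ^ d)⁻¹ : ℝ) : ℂ) *
      ∫ ξ in torus d, ((Real.exp (-t * symbol ξ ^ s) : ℝ) : ℂ) * charSum ξ f *
        Complex.exp (Complex.I * (pairing x ξ : ℂ)) := by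
  simp_rw [← charSum_semigroup hs0 hs1 t]
  rw [inv_two_pi_pow_mul_integral_charSum]

theorem heatKernel_eq [NeZero d] (hs0 : 0 < s) (hs1 : s ≤ 1) (t : ℝ) :
    heatKernel s t = semigroup d s t (delta 0) := by
  funext x
  simp_rw [semigroup_apply_eq hs0 hs1, heatKernel, charSum_delta_zero, mul_one]

end FourierInversion

section CauchyProblem

theorem eqOn_Ici_of_hasDerivAt_Ioi {E : Type*} [NormedAddCommGroup E] [NormedSpace ℝ E]
    {F : E → E} {K : NNReal} (hF : LipschitzWith K F) {u v : ℝ → E} {a : ℝ}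
    (hu : ContinuousOn u (Set.Ici a)) (hu' : ∀ t, a < t → HasDerivAt u (F (u t)) t)
    (hv : ContinuousOn v (Set.Ici a)) (hv' : ∀ t, a < t → HasDerivAt v (F (v t)) t)
    (ha : u a = v a) : Set.EqOn u v (Set.Ici a) := by
  have hderiv {w : ℝ → E} (hw : ContinuousOn w (Set.Ici a))
      (hw' : ∀ t, a < t → HasDerivAt w (F (w t)) t) {t : ℝ} (ht : a ≤ t) :
      HasDerivWithinAt w (F (w t)) (Set.Ici t) t := by
    have hsub : Set.Ioi t ⊆ Set.Ioi a := Set.Ioi_subset_Ioi ht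
    have hwt : ContinuousWithinAt w (Set.Ioi t) t :=
      (hw t ht).mono (hsub.trans Set.Ioi_subset_Ici_self)
    refine hasDerivWithinAt_Ici_of_tendsto_deriv
      (fun r hr => (hw' r (hsub hr)).differentiableAt.differentiableWithinAt) hwt
      self_mem_nhdsWithin ((hF.continuous.tendsto _).comp hwt |>.congr' ?_)
    filter_upwards [self_mem_nhdsWithin] with r hr using (hw' r (hsub hr)).deriv.symm
  intro t ht
  exact ODE_solution_unique (fun _ => hF) (hu.mono Set.Icc_subset_Ici_self)
    (fun r hr => hderiv hu hu' hr.1) (hv.mono Set.Icc_subset_Ici_self)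
    (fun r hr => hderiv hv hv' hr.1) ha (Set.right_mem_Icc.2 ht)

variable {d : ℕ} {s : ℝ} {u₀ : Ell1 d} {u v : ℝ → Ell1 d}

theorem isSolution_semigroup [NeZero d] (hs0 : 0 < s) (hs1 : s ≤ 1) (u₀ : Ell1 d) :
    IsSolution s u₀ fun t => semigroup d s t u₀ where
  initial := by rw [semigroup_zero, one_apply_eq_self]
  continuousOn := fun t _ => (hasDerivAt_semigroup_apply s u₀ t).continuousAt.continuousWithinAt
  equation := fun t _ => ⟨_, hasDerivAt_semigroup_apply s u₀ t, fun x => by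
    rw [fracLaplacian_eq hs0 hs1, lp.coeFn_neg, Pi.neg_apply, neg_add_cancel]⟩

theorem IsSolution.hasDerivAt [NeZero d] (hs0 : 0 < s) (hs1 : s ≤ 1) (hu : IsSolution s u₀ u)
    {t : ℝ} (ht : 0 < t) : HasDerivAt u (-fracOp d s (u t)) t := by
  obtain ⟨w, hw, hwx⟩ := hu.equation t ht
  rw [fracLaplacian_eq hs0 hs1] at hwx
  rwa [← eq_neg_of_add_eq_zero_left (lp.ext (funext hwx) : w + fracOp d s (u t) = 0)]

theorem IsSolution.eqOn [NeZero d] (hs0 : 0 < s) (hs1 : s ≤ 1) (hu : IsSolution s u₀ u)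
    (hv : IsSolution s u₀ v) : Set.EqOn u v (Set.Ici 0) :=
  eqOn_Ici_of_hasDerivAt_Ioi (-fracOp d s).lipschitz
    hu.continuousOn (fun _ => hu.hasDerivAt hs0 hs1)
    hv.continuousOn (fun _ => hv.hasDerivAt hs0 hs1) (hu.initial.trans hv.initial.symm)

end CauchyProblem

section Decay

variable {d : ℕ} {s t : ℝ}

theorem norm_le_sqrt_symbol {ξ : Fin d → ℝ} (hξ : ξ ∈ torus d) :
    2 / Real.pi * ‖ξ‖ ≤ √(symbol ξ) := by
  rw [← le_div_iff₀' (by positivity), pi_norm_le_iff_of_nonneg (by positivity)]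
  intro j
  rw [le_div_iff₀' (by positivity), Real.norm_eq_abs]
  refine Real.le_sqrt_of_sq_le ?_
  have hsin : 2 / Real.pi * |ξ j| ≤ 2 * |Real.sin (ξ j / 2)| := by
    have hj : |ξ j| ≤ Real.pi := abs_le.2 ⟨hξ.1 j, hξ.2 j⟩
    have h := Real.mul_abs_le_abs_sin (x := ξ j / 2) (by rw [abs_div, abs_two]; linarith)
    rw [abs_div, abs_two] at h
    linarith
  calc (2 / Real.pi * |ξ j|) ^ 2 ≤ (2 * |Real.sin (ξ j / 2)|) ^ 2 := by gcongr
    _ = 4 * Real.sin (ξ j / 2) ^ 2 := by rw [mul_pow, sq_abs]; norm_num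
    _ ≤ symbol ξ := by
      unfold symbol
      gcongr
      exact Finset.single_le_sum (f := fun i => Real.sin (ξ i / 2) ^ 2)
        (fun _ _ => sq_nonneg _) (Finset.mem_univ j)

theorem integrable_exp_neg_norm_rpow {E : Type*} [NormedAddCommGroup E] [NormedSpace ℝ E]
    [Nontrivial E] [FiniteDimensional ℝ E] [MeasurableSpace E] [BorelSpace E] (μ : Measure E)
    [μ.IsAddHaarMeasure] {p : ℝ} (hp : 0 < p) : Integrable (fun x => Real.exp (-‖x‖ ^ p)) μ := by
  rw [integrable_fun_norm_addHaar μ (f := fun r : ℝ => Real.exp (-r ^ p))]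
  simpa only [neg_one_mul, Real.rpow_natCast, smul_eq_mul] using
    integrableOn_rpow_mul_exp_neg_mul_rpow (s := (Module.finrank ℝ E - 1 : ℕ)) (b := 1)
      (by linarith [(Module.finrank ℝ E - 1).cast_nonneg (α := ℝ)]) hp one_pos

/-- The constant `(π / 2)^d ∫ exp (-‖η‖_∞^(2s)) dη` of the bound
`∫_{𝕋ᵈ} e^{-t ω(ξ)^s} dξ ≤ decayConst d s * t^(-d/2s)`. -/
def decayConst (d : ℕ) (s : ℝ) : ℝ :=
  ((2 / Real.pi) ^ d)⁻¹ * ∫ η : Fin d → ℝ, Real.exp (-‖η‖ ^ (2 * s))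

theorem norm_smul_rpow_le_mul_symbol_rpow (hs0 : 0 < s) (ht : 0 ≤ t) {ξ : Fin d → ℝ}
    (hξ : ξ ∈ torus d) :
    ‖(2 / Real.pi * t ^ (1 / (2 * s))) • ξ‖ ^ (2 * s) ≤ t * symbol ξ ^ s := by
  calc ‖(2 / Real.pi * t ^ (1 / (2 * s))) • ξ‖ ^ (2 * s)
      = (t ^ (1 / (2 * s)) * (2 / Real.pi * ‖ξ‖)) ^ (2 * s) := by
        rw [norm_smul, Real.norm_of_nonneg (by positivity)]
        ring_nf
    _ ≤ (t ^ (1 / (2 * s)) * √(symbol ξ)) ^ (2 * s) := by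
        gcongr
        exact norm_le_sqrt_symbol hξ
    _ = t * symbol ξ ^ s := by
        rw [Real.mul_rpow (by positivity) (by positivity), ← Real.rpow_mul ht,
          one_div_mul_cancel (by positivity), Real.rpow_one, Real.sqrt_eq_rpow,
          ← Real.rpow_mul (symbol_nonneg ξ), one_div, inv_mul_cancel_left₀ two_ne_zero]

theorem integral_exp_neg_norm_smul_rpow (ht : 0 ≤ t) :
    ∫ ξ : Fin d → ℝ, Real.exp (-‖(2 / Real.pi * t ^ (1 / (2 * s))) • ξ‖ ^ (2 * s))
      = decayConst d s * t ^ (-((d : ℝ) / (2 * s))) := by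
  have hpow : (t ^ (1 / (2 * s))) ^ d = t ^ ((d : ℝ) / (2 * s)) := by
    rw [← Real.rpow_mul_natCast ht, one_div_mul_eq_div]
  rw [Measure.integral_comp_smul_of_nonneg volume
      (fun η : Fin d → ℝ => Real.exp (-‖η‖ ^ (2 * s))) _
      (hR := by positivity),
    Module.finrank_fin_fun, decayConst, mul_pow, hpow, Real.rpow_neg ht, mul_inv, smul_eq_mul]
  ring

theorem continuous_exp_neg_mul_symbol_rpow (hs0 : 0 ≤ s) :
    Continuous fun ξ : Fin d → ℝ => Real.exp (-t * symbol ξ ^ s) :=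
  Real.continuous_exp.comp
    (continuous_const.mul (continuous_symbol.rpow_const fun _ => Or.inr hs0))

theorem integral_exp_neg_symbol_le [NeZero d] (hs0 : 0 < s) (ht : 0 < t) :
    ∫ ξ in torus d, Real.exp (-t * symbol ξ ^ s)
      ≤ decayConst d s * t ^ (-((d : ℝ) / (2 * s))) := by
  have hscale : 2 / Real.pi * t ^ (1 / (2 * s)) ≠ 0 := by positivity
  have hint := (integrable_exp_neg_norm_rpow (E := Fin d → ℝ) volume
    (by positivity : 0 < 2 * s)).comp_smul hscale
  rw [← integral_exp_neg_norm_smul_rpow ht.le]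
  calc ∫ ξ in torus d, Real.exp (-t * symbol ξ ^ s)
      ≤ ∫ ξ in torus d, Real.exp (-‖(2 / Real.pi * t ^ (1 / (2 * s))) • ξ‖ ^ (2 * s)) := by
        refine setIntegral_mono_on ((continuous_exp_neg_mul_symbol_rpow hs0.le).continuousOn
          |>.integrableOn_compact isCompact_Icc) hint.integrableOn measurableSet_Icc fun ξ hξ => ?_
        rw [Real.exp_le_exp, neg_mul, neg_le_neg_iff]
        exact norm_smul_rpow_le_mul_symbol_rpow hs0 ht.le hξ
    _ ≤ ∫ ξ, Real.exp (-‖(2 / Real.pi * t ^ (1 / (2 * s))) • ξ‖ ^ (2 * s)) :=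
        setIntegral_le_integral hint (Eventually.of_forall fun _ => (Real.exp_pos _).le)

theorem norm_semigroup_apply_le [NeZero d] (hs0 : 0 < s) (hs1 : s ≤ 1) (ht : 0 < t)
    (f : Ell1 d) (x : Fin d → ℤ) :
    ‖semigroup d s t f x‖
      ≤ ((2 * Real.pi) ^ d)⁻¹ * (decayConst d s * t ^ (-((d : ℝ) / (2 * s)))) * ‖f‖ := by
  rw [semigroup_apply_eq hs0 hs1, norm_mul, Complex.norm_real,
    Real.norm_of_nonneg (by positivity), mul_assoc]
  gcongr
  calc _ ≤ ∫ ξ in torus d, Real.exp (-t * symbol ξ ^ s) * ‖f‖ := by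
        refine norm_integral_le_of_norm_le
          (((continuous_exp_neg_mul_symbol_rpow hs0.le).mul_const _).continuousOn
            |>.integrableOn_compact isCompact_Icc) (Eventually.of_forall fun ξ => ?_)
        rw [norm_mul, norm_mul, Complex.norm_real, Complex.norm_exp_I_mul_ofReal, mul_one,
          Real.norm_of_nonneg (Real.exp_pos _).le]
        gcongr
        exact norm_charSum_le ξ f
    _ ≤ _ := by
        rw [integral_mul_const]
        gcongr
        exact integral_exp_neg_symbol_le hs0 ht

theorem rpow_mul_norm_semigroup_apply_le [NeZero d] (hs0 : 0 < s) (hs1 : s ≤ 1) (ht : 0 < t)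
    (f : Ell1 d) (x : Fin d → ℤ) :
    t ^ ((d : ℝ) / (2 * s)) * ‖semigroup d s t f x‖
      ≤ ((2 * Real.pi) ^ d)⁻¹ * decayConst d s * 2 ^ ((d : ℝ) / (2 * s)) *
        ‖semigroup d s (t / 2) f‖ := by
  have hhalf : semigroup d s t f = semigroup d s (t / 2) (semigroup d s (t / 2) f) := by
    rw [← mul_apply_eq_comp, ← semigroup_add, add_halves]
  have hscale : t ^ ((d : ℝ) / (2 * s)) * (t / 2) ^ (-((d : ℝ) / (2 * s)))
      = 2 ^ ((d : ℝ) / (2 * s)) := by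
    rw [Real.rpow_neg (by positivity), ← Real.inv_rpow (by positivity),
      ← Real.mul_rpow ht.le (by positivity), inv_div, mul_div_cancel₀ _ ht.ne']
  rw [hhalf]
  calc _ ≤ t ^ ((d : ℝ) / (2 * s)) * (((2 * Real.pi) ^ d)⁻¹ *
        (decayConst d s * (t / 2) ^ (-((d : ℝ) / (2 * s)))) * ‖semigroup d s (t / 2) f‖) := by
        gcongr
        exact norm_semigroup_apply_le hs0 hs1 (half_pos ht) _ x
    _ = _ := by
        rw [← hscale]
        ring

end Decay

section Interpolation

theorem eLpNorm_le_eLpNorm_one_rpow_mul_eLpNorm_top_rpow {α E : Type*} [MeasurableSpace α]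
    {μ : Measure α} [NormedAddCommGroup E] {f : α → E} (hf : AEStronglyMeasurable f μ) {p : ℝ≥0∞}
    (hp : 1 ≤ p) :
    eLpNorm f p μ ≤ eLpNorm f 1 μ ^ (p⁻¹).toReal * eLpNorm f ∞ μ ^ (1 - (p⁻¹).toReal) := by
  rcases eq_or_ne p ∞ with rfl | hpt
  · simp
  have hp1 : 1 ≤ p.toReal := ENNReal.toReal_one ▸ ENNReal.toReal_mono hpt hp
  have hp0 : 0 < p.toReal := by positivity
  have hpointwise : ∀ᵐ x ∂μ, ‖f x‖ₑ ^ p.toReal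
      ≤ ‖f x‖ₑ * eLpNormEssSup f μ ^ (p.toReal - 1) := by
    filter_upwards [enorm_ae_le_eLpNormEssSup f μ] with x hx
    calc ‖f x‖ₑ ^ p.toReal = ‖f x‖ₑ ^ (1 + (p.toReal - 1)) := by rw [add_sub_cancel]
      _ = ‖f x‖ₑ * ‖f x‖ₑ ^ (p.toReal - 1) := by
        rw [ENNReal.rpow_add_of_nonneg _ _ zero_le_one (by linarith), ENNReal.rpow_one]
      _ ≤ _ := by gcongr
  rw [eLpNorm_eq_lintegral_rpow_enorm_toReal (zero_lt_one.trans_le hp).ne' hpt,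
    eLpNorm_one_eq_lintegral_enorm, eLpNorm_exponent_top, ENNReal.toReal_inv, one_div]
  calc (∫⁻ x, ‖f x‖ₑ ^ p.toReal ∂μ) ^ p.toReal⁻¹
      ≤ ((∫⁻ x, ‖f x‖ₑ ∂μ) * eLpNormEssSup f μ ^ (p.toReal - 1)) ^ p.toReal⁻¹ := by
        rw [← lintegral_mul_const'' _ hf.enorm]
        exact ENNReal.rpow_le_rpow (lintegral_mono_ae hpointwise) (by positivity)
    _ = _ := by
        rw [ENNReal.mul_rpow_of_nonneg _ _ (by positivity), ← ENNReal.rpow_mul, sub_mul,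
          mul_inv_cancel₀ hp0.ne', one_mul]

theorem tendsto_mul_eLpNorm_of_endpoints {α E : Type*} [MeasurableSpace α] {μ : Measure α}
    [NormedAddCommGroup E] {f : ℝ → α → E} {a : ℝ} {p : ℝ≥0∞}
    (hf : ∀ t, AEStronglyMeasurable (f t) μ) (hp : 1 ≤ p)
    (hone : Tendsto (fun t => eLpNorm (f t) 1 μ) atTop (𝓝 0))
    (htop : Tendsto (fun t => ENNReal.ofReal (t ^ a) * eLpNorm (f t) ∞ μ) atTop (𝓝 0)) :
    Tendsto (fun t => ENNReal.ofReal (t ^ (a * (1 - (p⁻¹).toReal))) * eLpNorm (f t) p μ)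
      atTop (𝓝 0) := by
  set q := (p⁻¹).toReal
  have hq0 : 0 ≤ q := ENNReal.toReal_nonneg
  have hq1 : 0 ≤ 1 - q := sub_nonneg.2
    (ENNReal.toReal_one ▸ ENNReal.toReal_mono ENNReal.one_ne_top (ENNReal.inv_le_one.2 hp))
  have hlim := ENNReal.Tendsto.mul
    (hone.ennrpow_const q) (Or.inr (ENNReal.rpow_ne_top_of_nonneg hq1 ENNReal.zero_ne_top))
    (htop.ennrpow_const (1 - q)) (Or.inr (ENNReal.rpow_ne_top_of_nonneg hq0 ENNReal.zero_ne_top))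
  rw [← ENNReal.rpow_add_of_nonneg _ _ hq0 hq1, add_sub_cancel, ENNReal.rpow_one] at hlim
  refine tendsto_of_tendsto_of_tendsto_of_le_of_le' tendsto_const_nhds hlim
    (Eventually.of_forall fun _ => zero_le) ((eventually_gt_atTop 0).mono fun t ht => ?_)
  calc ENNReal.ofReal (t ^ (a * (1 - q))) * eLpNorm (f t) p μ
      ≤ ENNReal.ofReal (t ^ a) ^ (1 - q)
          * (eLpNorm (f t) 1 μ ^ q * eLpNorm (f t) ∞ μ ^ (1 - q)) := by
        rw [Real.rpow_mul ht.le, ENNReal.ofReal_rpow_of_nonneg (by positivity) hq1]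
        gcongr
        exact eLpNorm_le_eLpNorm_one_rpow_mul_eLpNorm_top_rpow (hf t) hp
    _ = _ := by
        rw [ENNReal.mul_rpow_of_nonneg _ _ hq1]
        ring

end Interpolation

section Asymptotics

variable {d : ℕ} {s : ℝ}

theorem ellNorm_one (f : Ell1 d) : ellNorm 1 f = ENNReal.ofReal ‖f‖ := by
  rw [ellNorm, eLpNorm_one_eq_lintegral_enorm, lintegral_count, norm_eq_tsum,
    ENNReal.ofReal_tsum_of_nonneg (fun _ => norm_nonneg _) (summable_norm f)]
  simp_rw [ofReal_norm]

theorem ellNorm_top_le {f : (Fin d → ℤ) → ℂ} {C : ℝ} (hC : ∀ x, ‖f x‖ ≤ C) :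
    ellNorm ∞ f ≤ ENNReal.ofReal C := by
  rw [ellNorm, eLpNorm_exponent_top]
  exact eLpNormEssSup_le_of_ae_bound (Eventually.of_forall hC)

theorem tendsto_ellNorm_one_semigroup_sub_mass (hs0 : 0 < s) (hs1 : s ≤ 1) (f : Ell1 d) :
    Tendsto (fun t => ellNorm 1 (semigroup d s t (f - mass f • delta 0))) atTop (𝓝 0) := by
  simp_rw [ellNorm_one]
  simpa using ENNReal.tendsto_ofReal (tendsto_semigroup_sub_mass_smul_delta_zero hs0 hs1 f).norm

theorem tendsto_ellNorm_top_semigroup_sub_mass [NeZero d] (hs0 : 0 < s) (hs1 : s ≤ 1)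
    (f : Ell1 d) :
    Tendsto (fun t => ENNReal.ofReal (t ^ ((d : ℝ) / (2 * s))) *
      ellNorm ∞ (semigroup d s t (f - mass f • delta 0))) atTop (𝓝 0) := by
  have hlim := ENNReal.tendsto_ofReal
    (((tendsto_semigroup_sub_mass_smul_delta_zero hs0 hs1 f).norm.comp
      (tendsto_id.atTop_div_const (zero_lt_two' ℝ))).const_mul
      (((2 * Real.pi) ^ d)⁻¹ * decayConst d s * 2 ^ ((d : ℝ) / (2 * s))))
  rw [norm_zero, mul_zero, ENNReal.ofReal_zero] at hlim
  refine tendsto_of_tendsto_of_tendsto_of_le_of_le' tendsto_const_nhds hlim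
    (Eventually.of_forall fun _ => zero_le) ((eventually_gt_atTop 0).mono fun t ht => ?_)
  have ha : 0 < t ^ ((d : ℝ) / (2 * s)) := Real.rpow_pos_of_pos ht _
  have hsup := ellNorm_top_le fun x => (le_div_iff₀' ha).2
    (rpow_mul_norm_semigroup_apply_le hs0 hs1 ht (f - mass f • delta 0) x)
  refine (mul_le_mul_right hsup _).trans ?_
  rw [← ENNReal.ofReal_mul ha.le, mul_div_cancel₀ _ ha.ne']
  rfl

theorem tendsto_ellNorm_semigroup_sub_mass [NeZero d] (hs0 : 0 < s) (hs1 : s ≤ 1) (f : Ell1 d)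
    {p : ℝ≥0∞} (hp : 1 ≤ p) :
    Tendsto (fun t => ENNReal.ofReal (t ^ ((d : ℝ) / (2 * s) * (1 - (p⁻¹).toReal))) *
      ellNorm p (semigroup d s t (f - mass f • delta 0))) atTop (𝓝 0) :=
  tendsto_mul_eLpNorm_of_endpoints (fun _ => (measurable_of_countable _).aestronglyMeasurable) hp
    (tendsto_ellNorm_one_semigroup_sub_mass hs0 hs1 f)
    (tendsto_ellNorm_top_semigroup_sub_mass hs0 hs1 f)

theorem semigroup_sub_mass_mul_heatKernel [NeZero d] (hs0 : 0 < s) (hs1 : s ≤ 1) (t : ℝ)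
    (f : Ell1 d) :
    (fun x => semigroup d s t f x - mass f * heatKernel s t x)
      = semigroup d s t (f - mass f • delta 0) := by
  rw [heatKernel_eq hs0 hs1, map_sub, map_smul]
  rfl

end Asymptotics

end LatticeHeat

end

theorem theorem1p7 (d : ℕ) (hd : 1 ≤ d) (s : ℝ) (hs0 : 0 < s) (hs1 : s ≤ 1)
    (u₀ : LatticeHeat.Ell1 d) :
    ∃ u : ℝ → LatticeHeat.Ell1 d,
      -- `u` is the solution of the Cauchy problem: it is one, and there is no other
      LatticeHeat.IsSolution s u₀ u ∧
      (∀ v : ℝ → LatticeHeat.Ell1 d, LatticeHeat.IsSolution s u₀ v →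
        ∀ t : ℝ, 0 ≤ t → v t = u t) ∧
      Tendsto (fun t : ℝ => LatticeHeat.ellNorm 1
          (fun x => u t x - LatticeHeat.mass u₀ * LatticeHeat.heatKernel s t x))
        atTop (𝓝 0) ∧
      Tendsto (fun t : ℝ => ENNReal.ofReal (t ^ ((d : ℝ) / (2 * s))) * LatticeHeat.ellNorm ∞
          (fun x => u t x - LatticeHeat.mass u₀ * LatticeHeat.heatKernel s t x))
        atTop (𝓝 0) ∧
      ∀ p : ℝ≥0∞, 1 ≤ p →
        Tendsto (fun t : ℝ => ENNReal.ofReal (t ^ ((d : ℝ) / (2 * s) * (1 - (p⁻¹).toReal))) *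
            LatticeHeat.ellNorm p
              (fun x => u t x - LatticeHeat.mass u₀ * LatticeHeat.heatKernel s t x))
          atTop (𝓝 0) := by
  have : NeZero d := ⟨by lia⟩
  have hsol := LatticeHeat.isSolution_semigroup hs0 hs1 u₀
  refine ⟨_, hsol, fun v hv t ht => hv.eqOn hs0 hs1 hsol ht, ?_⟩
  simp only [LatticeHeat.semigroup_sub_mass_mul_heatKernel hs0 hs1]
  exact ⟨LatticeHeat.tendsto_ellNorm_one_semigroup_sub_mass hs0 hs1 u₀,
    LatticeHeat.tendsto_ellNorm_top_semigroup_sub_mass hs0 hs1 u₀,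
    fun _ hp => LatticeHeat.tendsto_ellNorm_semigroup_sub_mass hs0 hs1 u₀ hp⟩
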